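/- For each $n\ge 1$ let $p=p_n\ge 1$ and $q=q_n\ge 1$ be integers, let $\Sigma_0=\Sigma_{0,n}\in\mathbb R^{p\times p}$ and $\Psi_0=\Psi_{0,n}\in\mathbb R^{q\times q}$ be symmetric matrices, and let $Y_1,\dots,Y_n$ be independent random $p\times q$ matrices on a probability space with probability measure $P_n$, each with the centred matrix normal distribution with row covariance $\Sigma_0$ and column covariance $\Psi_0$, i.e. $\operatorname{vec}(Y_i)\sim N(0,\Psi_0\otimes\Sigma_0)$, where $\operatorname{vec}$ stacks columns. Assume that $\operatorname{tr}(\Psi_0)=q$ for all $n\ge1$; that there is a constant $\tau_1>0$ such that for all $n\ge 1$ all eigenvalues of $\Sigma_0$ and of $\Psi_0$ lie in the open interval $(\tau_1,1/\tau_1)$; and that, as $n\to\infty$, $$\frac{\max(p,\log n)}{q}=o(n)\qquad\text{and}\qquad \frac{\max(q,\log n)}{p}=o(n).$$ Put $$\hat\Sigma_H=\frac1{nq}\sum_{i=1}^n Y_iY_i^\top,\qquad \hat\Psi_H=\frac1{n\operatorname{tr}(\hat\Sigma_H)}\sum_{i=1}^n Y_i^\top Y_i ,$$ $$r_n=\sqrt{\frac{\max(p,\log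 n)}{nq}},\qquad s_n=\sqrt{\max\left(\frac{\max(p,\log n)}{nq},\frac{\max(q,\log n)}{np}\right)} .$$ Write $\|\cdot\|$ for the spectral norm, and $X_n=O_P(a_n)$ if for every $\varepsilon>0$ there is $M>0$ such that $P_n(|X_n|>Ma_n)\le\varepsilon$ for all sufficiently large $n$. Then $$\|\hat\Sigma_H-\Sigma_0\|=O_P(r_n),\qquad \|\hat\Psi_H-\Psi_0\|=O_P(s_n),$$ and both norms tend to $0$ in probability. Moreover, $\hat\Sigma_H$ and $\hat\Psi_H$ are invertible with probability tending to $1$, and $$\|\hat\Sigma_H^{-1}-\Sigma_0^{-1}\|=O_P(r_n),\qquad \|\hat\Psi_H^{-1}-\Psi_0^{-1}\|=O_P(s_n).$$ -/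

import Mathlib

open MeasureTheory ProbabilityTheory Filter Topology Asymptotics
open scoped Kronecker Matrix

-- `‖A‖` for a matrix `A` is the spectral norm (operator norm for Euclidean vectors).
open scoped Matrix.Norms.L2Operator

noncomputable section

namespace MatrixVariate

/-- `vec A`, the columns of `A` stacked, as a Euclidean vector; the coordinate `(j, i)`
is the entry `A i j`. -/
def vecE {p q : ℕ} (A : Matrix (Fin p) (Fin q) ℝ) : EuclideanSpace ℝ (Fin q × Fin p) :=
  WithLp.toLp 2 A.vec

/-- `Y` is a random `p × q` matrix with the centred matrix normal distribution with row
covariance `S` and column covariance `T`, that is, `vec Y ∼ N(0, T ⊗ S)`. -/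
def IsMatrixNormal {Ω : Type*} [MeasurableSpace Ω] {p q : ℕ} (P : Measure Ω)
    (Y : Ω → Matrix (Fin p) (Fin q) ℝ)
    (S : Matrix (Fin p) (Fin p) ℝ) (T : Matrix (Fin q) (Fin q) ℝ) : Prop :=
  HasLaw (fun ω => vecE (Y ω)) (multivariateGaussian 0 (T ⊗ₖ S)) P

/-- `Y 0, …, Y (n-1)` is an i.i.d. sample from the centred matrix normal distribution. -/
def IsMatrixNormalSample {Ω : Type*} [MeasurableSpace Ω] {n p q : ℕ} (P : Measure Ω)
    (Y : Fin n → Ω → Matrix (Fin p) (Fin q) ℝ)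
    (S : Matrix (Fin p) (Fin p) ℝ) (T : Matrix (Fin q) (Fin q) ℝ) : Prop :=
  (∀ i, IsMatrixNormal P (Y i) S T) ∧ iIndepFun (fun i ω => vecE (Y i ω)) P

/-- `A` is symmetric and all its eigenvalues lie in the open interval `(a, b)`. -/
def EigenvaluesIn {m : ℕ} (A : Matrix (Fin m) (Fin m) ℝ) (a b : ℝ) : Prop :=
  ∃ h : A.IsHermitian, ∀ i, a < h.eigenvalues i ∧ h.eigenvalues i < b

/-- The heuristic estimator `(nq)⁻¹ ∑ Yᵢ Yᵢᵀ` of the row covariance matrix. -/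
def sigmaHat {n p q : ℕ} (Y : Fin n → Matrix (Fin p) (Fin q) ℝ) : Matrix (Fin p) (Fin p) ℝ :=
  ((n : ℝ) * q)⁻¹ • ∑ i, Y i * (Y i)ᵀ

/-- The heuristic estimator `(n tr Σ̂)⁻¹ ∑ Yᵢᵀ Yᵢ` of the column covariance matrix. -/
def psiHat {n p q : ℕ} (Y : Fin n → Matrix (Fin p) (Fin q) ℝ) : Matrix (Fin q) (Fin q) ℝ :=
  ((n : ℝ) * (sigmaHat Y).trace)⁻¹ • ∑ i, (Y i)ᵀ * Y i

/-- `X n = O_P(r n)`: for every `ε > 0` there is a constant `M > 0` such that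
`P(|X n| > M r n) ≤ ε` for all large `n`. The `X n` may live on different probability spaces. -/
def IsBigOInProb {Ω : ℕ → Type*} [∀ n, MeasurableSpace (Ω n)] (P : ∀ n, Measure (Ω n))
    (X : ∀ n, Ω n → ℝ) (r : ℕ → ℝ) : Prop :=
  ∀ ε : ℝ, 0 < ε → ∃ M : ℝ, 0 < M ∧
    ∀ᶠ n in atTop, P n {ω | M * r n < |X n ω|} ≤ ENNReal.ofReal ε

/-- `X n → 0` in probability, the `X n` possibly living on different probability spaces. -/
def TendstoZeroInProb {Ω : ℕ → Type*} [∀ n, MeasurableSpace (Ω n)] (P : ∀ n, Measure (Ω n))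
    (X : ∀ n, Ω n → ℝ) : Prop :=
  ∀ ε : ℝ, 0 < ε → Tendsto (fun n => P n {ω | ε < |X n ω|}) atTop (𝓝 0)

/-- The rate `√(max(p, log n) / (nq))`. -/
def sigmaRate (p q : ℕ → ℕ) (n : ℕ) : ℝ :=
  √(max (p n : ℝ) (Real.log n) / ((n : ℝ) * q n))

/-- The rate `√(max(max(p, log n) / (nq), max(q, log n) / (np)))`. -/
def psiRate (p q : ℕ → ℕ) (n : ℕ) : ℝ :=
  √(max (max (p n : ℝ) (Real.log n) / ((n : ℝ) * q n))
    (max (q n : ℝ) (Real.log n) / ((n : ℝ) * p n)))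

end MatrixVariate

end

/-! For a fixed vector `v`, the vectors `Yᵢᵀ v` are i.i.d. `N(0, (vᵀ Σ₀ v) Ψ₀)`, so the quadratic
form of `∑ Yᵢ Yᵢᵀ` at `v` is a sum of squared norms of independent Gaussians, that is, a weighted
chi-square with about `nq` degrees of freedom. A Chernoff bound (`measureReal_sum_norm_sq_tail`)
makes its normalised deviation from the mean sub-Gaussian at scale `(nq)^(-1/2)`. The spectral norm
of a symmetric `p × p` matrix is controlled by its quadratic form on at most `2 * 25 ^ p` vectors
(`exists_finset_norm_le_of_quadratic`). The union bound therefore costs a factor exponential in `p`,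
which a deviation of order `√(max(p, log n) / (nq))` absorbs (`measureReal_norm_gram_sub_tail`).

Since `tr Ψ₀ = q`, this is the rate for the row estimator. Applied to the transposed sample, it
shows that `(np)⁻¹ ∑ Yᵢᵀ Yᵢ` is close to `(tr Σ₀ / p) Ψ₀`. Replacing `tr Σ₀` by the estimated trace
costs one more error of the order of the row rate (`norm_psiHat_sub_le`). Invertibility and the
rates for the inverses follow from a deterministic perturbation bound, because both errors tend to
zero and the spectra stay away from zero. -/

namespace MatrixVariate

open scoped RealInnerProductSpace

/-! ### Discretisation of the spectral norm. -/

/-- A finite set of vectors of norm at most `2` that is norming for the whole space, with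
cardinality at most exponential in the dimension. -/
theorem exists_norming_finset (E : Type*) [NormedAddCommGroup E] [InnerProductSpace ℝ E]
    [FiniteDimensional ℝ E] :
    ∃ s : Finset E, s.card ≤ 5 ^ Module.finrank ℝ E ∧ (∀ c ∈ s, ‖c‖ ≤ 2) ∧
      ∀ x : E, ∃ d ∈ s, ‖x‖ ≤ ⟪x, d⟫ := by
  classical
  -- A 1-separated subset of the ball of radius 2 has at most `5 ^ dim` points. One of maximal
  -- cardinality is a 1-net of that ball, since any uncovered point could be added.
  let Q : ℕ → Prop := fun N => ∃ s : Finset E, s.card = N ∧ (∀ c ∈ s, ‖c‖ ≤ 2) ∧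
    ∀ c ∈ s, ∀ d ∈ s, c ≠ d → 1 ≤ ‖c - d‖
  have hQ : ∀ N, Q N → N ≤ 5 ^ Module.finrank ℝ E := by
    rintro N ⟨s, rfl, h1, h2⟩
    exact Besicovitch.card_le_of_separated s h1 h2
  have h0 : Q 0 := ⟨∅, by simp⟩
  have hspec := Nat.findGreatest_spec (P := Q) (Nat.zero_le (5 ^ Module.finrank ℝ E)) h0
  have hmax : ∀ N, Q N → N ≤ Nat.findGreatest Q (5 ^ Module.finrank ℝ E) :=
    fun N hN => Nat.le_findGreatest (hQ N hN) hN
  obtain ⟨s, hcard, hs2, hsep⟩ := hspec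
  have hnet : ∀ y : E, ‖y‖ ≤ 2 → ∃ d ∈ s, ‖y - d‖ ≤ 1 := by
    intro y hy
    by_contra! hcon
    have hys : y ∉ s := fun hmem => by
      have := hcon y hmem
      simp at this
      linarith
    have : Q (s.card + 1) := by
      refine ⟨insert y s, Finset.card_insert_of_notMem hys, ?_, ?_⟩
      · intro c hc
        rcases Finset.mem_insert.1 hc with rfl | hc
        exacts [hy, hs2 c hc]
      · intro c hc d hd hne
        rcases Finset.mem_insert.1 hc with hc | hc <;> rcases Finset.mem_insert.1 hd with hd | hd
        · exact absurd (hc.trans hd.symm) hne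
        · rw [hc]; exact (hcon d hd).le
        · rw [hd, norm_sub_rev]; exact (hcon c hc).le
        · exact hsep c hc d hd hne
    have := hmax _ this
    omega
  refine ⟨s, hcard ▸ Nat.findGreatest_le _, hs2, fun x => ?_⟩
  rcases eq_or_ne x 0 with rfl | hx
  · obtain ⟨d, hd, -⟩ := hnet 0 (by simp)
    exact ⟨d, hd, by simp⟩
  · have hx' : 0 < ‖x‖ := norm_pos_iff.2 hx
    obtain ⟨d, hd, hd1⟩ := hnet ((2 * ‖x‖⁻¹) • x) (by
      rw [norm_smul, Real.norm_of_nonneg (by positivity), mul_assoc, inv_mul_cancel₀ hx'.ne']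
      norm_num)
    -- The net point `d` is within 1 of `2x/‖x‖`, so `⟪x, d⟫ ≥ 2‖x‖ - ‖x‖`.
    refine ⟨d, hd, ?_⟩
    have h1 : ⟪x, (2 * ‖x‖⁻¹) • x⟫ = 2 * ‖x‖ := by
      rw [real_inner_smul_right, real_inner_self_eq_norm_sq]; field_simp
    have h2 : ⟪x, (2 * ‖x‖⁻¹) • x - d⟫ ≤ ‖x‖ * 1 :=
      (real_inner_le_norm _ _).trans (by gcongr)
    rw [inner_sub_right, h1] at h2
    linarith

/-- The spectral norm of a symmetric matrix is controlled by the quadratic form on a finite set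
of exponential cardinality. -/
theorem exists_finset_norm_le_of_quadratic (p : ℕ) :
    ∃ N : Finset (EuclideanSpace ℝ (Fin p)), (N.card : ℝ) ≤ 2 * 25 ^ p ∧ (∀ v ∈ N, ‖v‖ ≤ 4) ∧
      ∀ (A : Matrix (Fin p) (Fin p) ℝ) (b : ℝ), A.IsHermitian →
        (∀ v ∈ N, |⟪v, Matrix.toEuclideanCLM (𝕜 := ℝ) A v⟫| ≤ b) → ‖A‖ ≤ b := by
  classical
  obtain ⟨s, hcard, hs2, hnorm⟩ := exists_norming_finset (EuclideanSpace ℝ (Fin p))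
  rw [finrank_euclideanSpace_fin] at hcard
  refine ⟨(s ×ˢ s).image (fun c => c.1 + c.2) ∪ (s ×ˢ s).image (fun c => c.1 - c.2), ?_, ?_, ?_⟩
  · have h1 := Finset.card_union_le ((s ×ˢ s).image (fun c => c.1 + c.2))
      ((s ×ˢ s).image (fun c => c.1 - c.2))
    have h2 := Finset.card_image_le (s := s ×ˢ s) (f := fun c => c.1 + c.2)
    have h3 := Finset.card_image_le (s := s ×ˢ s) (f := fun c => c.1 - c.2)
    rw [Finset.card_product] at h2 h3
    have h4 : s.card * s.card ≤ 25 ^ p := by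
      calc s.card * s.card ≤ 5 ^ p * 5 ^ p := Nat.mul_le_mul hcard hcard
        _ = 25 ^ p := by rw [← mul_pow]; norm_num
    exact_mod_cast (by omega : _ ≤ 2 * 25 ^ p)
  · intro v hv
    simp only [Finset.mem_union, Finset.mem_image, Finset.mem_product] at hv
    rcases hv with ⟨⟨c, d⟩, ⟨hc, hd⟩, rfl⟩ | ⟨⟨c, d⟩, ⟨hc, hd⟩, rfl⟩
    · exact (norm_add_le _ _).trans (by linarith [hs2 c hc, hs2 d hd])
    · exact (norm_sub_le _ _).trans (by linarith [hs2 c hc, hs2 d hd])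
  · intro A b hA hb
    set T := Matrix.toEuclideanCLM (𝕜 := ℝ) A with hT
    have hsymm : ∀ x y, ⟪T x, y⟫ = ⟪x, T y⟫ := by
      intro x y
      have := (Matrix.isSymmetric_toEuclideanLin_iff.2 hA) x y
      exact this
    have hbil : ∀ c ∈ s, ∀ d ∈ s, ⟪T c, d⟫ ≤ b := by
      intro c hc d hd
      have h1 := hb (c + d) (Finset.mem_union_left _
        (Finset.mem_image.2 ⟨(c, d), Finset.mk_mem_product hc hd, rfl⟩))
      have h2 := hb (c - d) (Finset.mem_union_right _
        (Finset.mem_image.2 ⟨(c, d), Finset.mk_mem_product hc hd, rfl⟩))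
      -- Polarisation: this is why the test set consists of sums and differences of net points. It
      -- yields even `b / 2`.
      have h3 : ⟪c + d, T (c + d)⟫ - ⟪c - d, T (c - d)⟫ = 4 * ⟪T c, d⟫ := by
        simp only [map_add, map_sub, inner_add_left, inner_add_right, inner_sub_left,
          inner_sub_right]
        rw [← hsymm c d, real_inner_comm (T c) d]
        ring
      have := abs_le.1 h1
      have := abs_le.1 h2
      have := abs_nonneg ⟪c + d, T (c + d)⟫
      linarith
    have hb0 : 0 ≤ b := by
      obtain ⟨d, hd, -⟩ := hnorm 0
      refine (abs_nonneg _).trans (hb (d + d) (Finset.mem_union_left _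
        (Finset.mem_image.2 ⟨(d, d), Finset.mk_mem_product hd hd, rfl⟩)))
    rw [Matrix.cstar_norm_def]
    refine ContinuousLinearMap.opNorm_le_bound _ hb0 fun x => ?_
    -- The norming set is used twice, for `T x` and then for `T d`, symmetry moving `T` from one
    -- side to the other.
    obtain ⟨d, hd, hd1⟩ := hnorm (T x)
    obtain ⟨c, hc, hc1⟩ := hnorm (T d)
    calc ‖T x‖ ≤ ⟪T x, d⟫ := hd1
      _ = ⟪x, T d⟫ := hsymm _ _
      _ ≤ ‖x‖ * ‖T d‖ := real_inner_le_norm _ _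
      _ ≤ ‖x‖ * b := by gcongr; exact hc1.trans (hbil d hd c hc)
      _ = b * ‖x‖ := mul_comm _ _

/-! ### Spectral bounds and perturbation of the inverse. -/

variable {m : ℕ} {A : Matrix (Fin m) (Fin m) ℝ}

theorem inner_eigenvectorBasis_toEuclideanCLM (hA : A.IsHermitian) (x : EuclideanSpace ℝ (Fin m))
    (i : Fin m) :
    ⟪hA.eigenvectorBasis i, Matrix.toEuclideanCLM (𝕜 := ℝ) A x⟫ =
      hA.eigenvalues i * ⟪hA.eigenvectorBasis i, x⟫ := by
  have h1 : Matrix.toEuclideanCLM (𝕜 := ℝ) A (hA.eigenvectorBasis i) =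
      hA.eigenvalues i • hA.eigenvectorBasis i := by
    ext j
    have := congrFun (hA.mulVec_eigenvectorBasis i) j
    simpa using this
  have h2 : ⟪Matrix.toEuclideanCLM (𝕜 := ℝ) A (hA.eigenvectorBasis i), x⟫ =
      ⟪hA.eigenvectorBasis i, Matrix.toEuclideanCLM (𝕜 := ℝ) A x⟫ :=
    (Matrix.isSymmetric_toEuclideanLin_iff.2 hA) _ x
  rw [← h2, h1, real_inner_smul_left]

theorem inner_toEuclideanCLM_self_eq_sum (hA : A.IsHermitian) (x : EuclideanSpace ℝ (Fin m)) :
    ⟪x, Matrix.toEuclideanCLM (𝕜 := ℝ) A x⟫ =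
      ∑ i, hA.eigenvalues i * ⟪hA.eigenvectorBasis i, x⟫ ^ 2 := by
  rw [← hA.eigenvectorBasis.sum_inner_mul_inner]
  refine Finset.sum_congr rfl fun i _ => ?_
  rw [inner_eigenvectorBasis_toEuclideanCLM, real_inner_comm]
  ring

theorem norm_toEuclideanCLM_sq_eq_sum (hA : A.IsHermitian) (x : EuclideanSpace ℝ (Fin m)) :
    ‖Matrix.toEuclideanCLM (𝕜 := ℝ) A x‖ ^ 2 =
      ∑ i, (hA.eigenvalues i) ^ 2 * ⟪hA.eigenvectorBasis i, x⟫ ^ 2 := by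
  rw [← hA.eigenvectorBasis.sum_sq_inner_right]
  refine Finset.sum_congr rfl fun i _ => ?_
  rw [inner_eigenvectorBasis_toEuclideanCLM]
  ring

theorem EigenvaluesIn.isHermitian {a b : ℝ} (h : EigenvaluesIn A a b) : A.IsHermitian := h.1

theorem EigenvaluesIn.posDef {a b : ℝ} (ha : 0 < a) (h : EigenvaluesIn A a b) : A.PosDef :=
  h.1.posDef_iff_eigenvalues_pos.2 fun i => ha.trans (h.2 i).1

theorem EigenvaluesIn.inner_le {a b : ℝ} (h : EigenvaluesIn A a b)
    (x : EuclideanSpace ℝ (Fin m)) :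
    ⟪x, Matrix.toEuclideanCLM (𝕜 := ℝ) A x⟫ ≤ b * ‖x‖ ^ 2 := by
  obtain ⟨hA, hb⟩ := h
  rw [inner_toEuclideanCLM_self_eq_sum hA, ← hA.eigenvectorBasis.sum_sq_inner_right,
    Finset.mul_sum]
  exact Finset.sum_le_sum fun i _ => mul_le_mul_of_nonneg_right (hb i).2.le (sq_nonneg _)

theorem EigenvaluesIn.norm_le {a b : ℝ} (ha : 0 < a) (hb : 0 < b) (h : EigenvaluesIn A a b) :
    ‖A‖ ≤ b := by
  obtain ⟨hA, hi⟩ := h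
  rw [Matrix.cstar_norm_def]
  refine ContinuousLinearMap.opNorm_le_bound _ hb.le fun x => ?_
  rw [← abs_of_nonneg (norm_nonneg (Matrix.toEuclideanCLM (𝕜 := ℝ) A x)),
    ← abs_of_nonneg (show 0 ≤ b * ‖x‖ by positivity)]
  rw [← sq_le_sq, norm_toEuclideanCLM_sq_eq_sum hA, mul_pow,
    ← hA.eigenvectorBasis.sum_sq_inner_right x, Finset.mul_sum]
  refine Finset.sum_le_sum fun i _ => mul_le_mul_of_nonneg_right ?_ (sq_nonneg _)
  exact pow_le_pow_left₀ (ha.trans (hi i).1).le (hi i).2.le 2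

theorem EigenvaluesIn.isUnit {a b : ℝ} (ha : 0 < a) (h : EigenvaluesIn A a b) : IsUnit A :=
  (h.posDef ha).isUnit

theorem EigenvaluesIn.norm_inv_le {a b : ℝ} (ha : 0 < a) (h : EigenvaluesIn A a b) :
    ‖A⁻¹‖ ≤ a⁻¹ := by
  have hu := h.isUnit ha
  obtain ⟨hA, hi⟩ := h
  rw [Matrix.cstar_norm_def]
  refine ContinuousLinearMap.opNorm_le_bound _ (by positivity) fun x => ?_
  set y := Matrix.toEuclideanCLM (𝕜 := ℝ) A⁻¹ x with hy
  have hxy : x = Matrix.toEuclideanCLM (𝕜 := ℝ) A y := by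
    rw [hy, ← ContinuousLinearMap.comp_apply, ← ContinuousLinearMap.mul_def, ← map_mul,
      Matrix.mul_nonsing_inv _ ((Matrix.isUnit_iff_isUnit_det _).1 hu), map_one]
    rfl
  -- Coercivity in the eigenbasis: every squared eigenvalue is at least `a ^ 2`.
  have key : a * ‖y‖ ≤ ‖x‖ := by
    rw [hxy, ← abs_of_nonneg (norm_nonneg (Matrix.toEuclideanCLM (𝕜 := ℝ) A y)),
      ← abs_of_nonneg (show 0 ≤ a * ‖y‖ by positivity)]
    rw [← sq_le_sq, norm_toEuclideanCLM_sq_eq_sum hA, mul_pow,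
      ← hA.eigenvectorBasis.sum_sq_inner_right y, Finset.mul_sum]
    refine Finset.sum_le_sum fun i _ => mul_le_mul_of_nonneg_right ?_ (sq_nonneg _)
    exact pow_le_pow_left₀ ha.le (hi i).1.le 2
  rw [inv_mul_eq_div, le_div_iff₀ ha]
  linarith

theorem EigenvaluesIn.le_trace {a b : ℝ} (h : EigenvaluesIn A a b) : m * a ≤ A.trace := by
  obtain ⟨hA, hi⟩ := h
  rw [hA.trace_eq_sum_eigenvalues]
  calc (m : ℝ) * a = ∑ _i : Fin m, a := by simp
    _ ≤ _ := Finset.sum_le_sum fun i _ => by simpa using (hi i).1.le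

theorem abs_trace_le (A : Matrix (Fin m) (Fin m) ℝ) : |A.trace| ≤ m * ‖A‖ := by
  have h : ∀ i, |A i i| ≤ ‖A‖ := by
    intro i
    have h1 := (Matrix.toEuclideanCLM (𝕜 := ℝ) A).le_opNorm (EuclideanSpace.single i 1)
    rw [← Matrix.cstar_norm_def] at h1
    have h2 := PiLp.norm_apply_le (Matrix.toEuclideanCLM (𝕜 := ℝ) A (EuclideanSpace.single i 1)) i
    simp at h1 h2
    exact h2.trans h1
  calc |A.trace| ≤ ∑ i, |A i i| := Finset.abs_sum_le_sum_abs _ _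
    _ ≤ ∑ _i : Fin m, ‖A‖ := Finset.sum_le_sum fun i _ => h i
    _ = m * ‖A‖ := by simp

/-- Perturbation of the matrix inverse. -/
theorem isUnit_and_norm_inv_sub_inv_le {B : Matrix (Fin m) (Fin m) ℝ} {a : ℝ} (ha : 0 < a)
    (hA : IsUnit A) (hAinv : ‖A⁻¹‖ ≤ a⁻¹) (hB : ‖B - A‖ ≤ a / 2) :
    IsUnit B ∧ ‖B⁻¹ - A⁻¹‖ ≤ 2 / a ^ 2 * ‖B - A‖ := by
  have hAd := (Matrix.isUnit_iff_isUnit_det _).1 hA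
  have hsmall : ‖A⁻¹ * (B - A)‖ ≤ 1 / 2 := by
    calc ‖A⁻¹ * (B - A)‖ ≤ ‖A⁻¹‖ * ‖B - A‖ := norm_mul_le _ _
      _ ≤ a⁻¹ * (a / 2) := by gcongr
      _ = 1 / 2 := by field_simp
  have hBA : B = A * (1 - -(A⁻¹ * (B - A))) := by
    rw [sub_neg_eq_add, mul_add, ← mul_assoc, Matrix.mul_nonsing_inv _ hAd]
    simp
  have hu : IsUnit B := by
    rw [hBA]
    refine hA.mul (isUnit_one_sub_of_norm_lt_one ?_)
    rw [norm_neg]; linarith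
  have hBd := (Matrix.isUnit_iff_isUnit_det _).1 hu
  have hdiff : B⁻¹ - A⁻¹ = -(B⁻¹ * (B - A) * A⁻¹) := by
    rw [mul_sub, sub_mul, Matrix.nonsing_inv_mul _ hBd, mul_assoc B⁻¹,
      Matrix.mul_nonsing_inv _ hAd]
    simp
  have hle : ‖B⁻¹ - A⁻¹‖ ≤ ‖B⁻¹‖ * ‖B - A‖ * a⁻¹ := by
    rw [hdiff, norm_neg]
    calc _ ≤ ‖B⁻¹ * (B - A)‖ * ‖A⁻¹‖ := norm_mul_le _ _
      _ ≤ ‖B⁻¹‖ * ‖B - A‖ * a⁻¹ := by gcongr; exact norm_mul_le _ _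
  -- Self-bounding: `‖B⁻¹‖ ≤ ‖B⁻¹‖ / 2 + a⁻¹`.
  have hBn : ‖B⁻¹‖ ≤ 2 * a⁻¹ := by
    have h1 : ‖B⁻¹‖ ≤ ‖B⁻¹ - A⁻¹‖ + ‖A⁻¹‖ := by
      simpa using norm_add_le (B⁻¹ - A⁻¹) A⁻¹
    have h2 : ‖B⁻¹‖ * ‖B - A‖ * a⁻¹ ≤ ‖B⁻¹‖ / 2 := by
      calc ‖B⁻¹‖ * ‖B - A‖ * a⁻¹ ≤ ‖B⁻¹‖ * (a / 2) * a⁻¹ := by gcongr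
        _ = ‖B⁻¹‖ / 2 := by field_simp
    linarith
  refine ⟨hu, hle.trans ?_⟩
  calc ‖B⁻¹‖ * ‖B - A‖ * a⁻¹ ≤ (2 * a⁻¹) * ‖B - A‖ * a⁻¹ := by gcongr
    _ = 2 / a ^ 2 * ‖B - A‖ := by field_simp

/-! ### Moment generating function and tails of squared Gaussian norms. -/

open scoped MatrixOrder

theorem integral_exp_mul_sq_gaussianReal {a : ℝ} (ha : a < 1 / 2) :
    ∫ x, Real.exp (a * x ^ 2) ∂(gaussianReal 0 1) = (√(1 - 2 * a))⁻¹ := by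
  rw [integral_gaussianReal_eq_integral_smul one_ne_zero]
  have h : ∀ x : ℝ, gaussianPDFReal 0 1 x • Real.exp (a * x ^ 2) =
      (√(2 * Real.pi))⁻¹ * Real.exp (-(1 / 2 - a) * x ^ 2) := by
    intro x
    rw [gaussianPDFReal, smul_eq_mul, mul_assoc, ← Real.exp_add]
    simp only [NNReal.coe_one, mul_one, sub_zero]
    congr 2
    ring
  simp_rw [h]
  have h1 : 0 < 1 - 2 * a := by linarith
  rw [integral_const_mul, integral_gaussian, ← Real.sqrt_inv, ← Real.sqrt_inv,
    ← Real.sqrt_mul (by positivity)]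
  congr 1
  have : (1 / 2 - a) = (1 - 2 * a) / 2 := by ring
  rw [this]
  have := Real.pi_pos
  field_simp

/-- The first-order expansion of `log (1 - 2a)` has remainder at most `8 * a ^ 2`; halving gives `4
* a ^ 2`. -/
theorem inv_sqrt_one_sub_two_mul_le {a : ℝ} (ha : |a| ≤ 1 / 4) :
    (√(1 - 2 * a))⁻¹ ≤ Real.exp (a + 4 * a ^ 2) := by
  have ha' := abs_le.1 ha
  have hpos : 0 < 1 - 2 * a := by linarith
  have h2 : |2 * a| ≤ 1 / 2 := by rw [abs_mul, abs_two]; linarith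
  have h := Real.abs_log_sub_add_sum_range_le (x := 2 * a) (by linarith) 1
  simp only [Finset.range_one, Finset.sum_singleton, zero_add, pow_one, Nat.cast_zero, div_one,
    one_add_one_eq_two] at h
  have h3 : |2 * a| ^ 2 / (1 - |2 * a|) ≤ 8 * a ^ 2 := by
    rw [div_le_iff₀ (by linarith), sq_abs]
    nlinarith [sq_nonneg a]
  have h4 := (abs_le.1 (h.trans h3)).1
  rw [← Real.exp_log (inv_pos.2 (Real.sqrt_pos.2 hpos)), Real.exp_le_exp, Real.log_inv,
    Real.log_sqrt hpos.le]
  linarith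

variable {d : ℕ} {C : Matrix (Fin d) (Fin d) ℝ}

/-- With `x = √C g` and `g` standard Gaussian, `‖x‖² = ⟪g, C g⟫`. In an eigenbasis of `C` the
coordinates of `g` are again independent standard normals, so the expectation factors over the
eigenvalues. -/
theorem mgf_norm_sq_multivariateGaussian (hC : C.PosSemidef) {s : ℝ}
    (hs : ∀ j, s * hC.1.eigenvalues j < 1 / 2) :
    mgf (fun x => ‖x‖ ^ 2) (multivariateGaussian 0 C) s =
      ∏ j, (√(1 - 2 * (s * hC.1.eigenvalues j)))⁻¹ := by
  have hn : ∀ x : EuclideanSpace ℝ (Fin d),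
      ‖(0 : EuclideanSpace ℝ (Fin d)) + Matrix.toEuclideanCLM (𝕜 := ℝ) (CFC.sqrt C) x‖ ^ 2 =
      ∑ j, hC.1.eigenvalues j * ⟪hC.1.eigenvectorBasis j, x⟫ ^ 2 := by
    intro x
    have hsa : IsSelfAdjoint (Matrix.toEuclideanCLM (𝕜 := ℝ) (CFC.sqrt C)) :=
      (CFC.sqrt_nonneg C).isSelfAdjoint.map _
    rw [zero_add, ← real_inner_self_eq_norm_sq, ← ContinuousLinearMap.adjoint_inner_right,
      hsa.adjoint_eq, ← ContinuousLinearMap.comp_apply, ← ContinuousLinearMap.mul_def, ← map_mul,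
      CFC.sqrt_mul_sqrt_self _ hC.nonneg, inner_toEuclideanCLM_self_eq_sum hC.1]
  rw [mgf, multivariateGaussian, integral_map (by fun_prop)
    (by apply Continuous.aestronglyMeasurable; fun_prop)]
  simp_rw [hn]
  rw [stdGaussian_eq_map_pi_orthonormalBasis hC.1.eigenvectorBasis,
    integral_map (Measurable.aemeasurable (by fun_prop))
      (by apply Continuous.aestronglyMeasurable; fun_prop)]
  have hx : ∀ (x : Fin d → ℝ) j,
      ⟪hC.1.eigenvectorBasis j, ∑ i, x i • hC.1.eigenvectorBasis i⟫ = x j := by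
    intro x j
    exact hC.1.eigenvectorBasis.orthonormal.inner_right_fintype x j
  simp_rw [hx, Finset.mul_sum, Real.exp_sum]
  rw [integral_fintype_prod_eq_prod
    (f := fun j (y : ℝ) => Real.exp (s * (hC.1.eigenvalues j * y ^ 2)))]
  refine Finset.prod_congr rfl fun j _ => ?_
  simp_rw [← mul_assoc]
  rw [integral_exp_mul_sq_gaussianReal (hs j)]
  simp [mul_assoc]

theorem mgf_norm_sq_multivariateGaussian_bounds (hC : C.PosSemidef) {s κ : ℝ}
    (hκ : ∀ x : EuclideanSpace ℝ (Fin d), ⟪x, Matrix.toEuclideanCLM (𝕜 := ℝ) C x⟫ ≤ κ * ‖x‖ ^ 2)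
    (hs : |s| * κ ≤ 1 / 4) :
    0 < mgf (fun x => ‖x‖ ^ 2) (multivariateGaussian 0 C) s ∧
      mgf (fun x => ‖x‖ ^ 2) (multivariateGaussian 0 C) s ≤
        Real.exp (s * C.trace + 4 * s ^ 2 * (d * κ ^ 2)) := by
  have h0 : ∀ j, 0 ≤ hC.1.eigenvalues j := hC.eigenvalues_nonneg
  have h1 : ∀ j, hC.1.eigenvalues j ≤ κ := by
    intro j
    have h := hκ (hC.1.eigenvectorBasis j)
    rwa [inner_eigenvectorBasis_toEuclideanCLM, real_inner_self_eq_norm_sq,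
      hC.1.eigenvectorBasis.norm_eq_one, one_pow, mul_one, mul_one] at h
  have h2 : ∀ j, |s * hC.1.eigenvalues j| ≤ 1 / 4 := by
    intro j
    rw [abs_mul, abs_of_nonneg (h0 j)]
    exact (mul_le_mul_of_nonneg_left (h1 j) (abs_nonneg s)).trans hs
  have h3 : ∀ j, s * hC.1.eigenvalues j < 1 / 2 := fun j => by
    linarith [(abs_le.1 (h2 j)).2]
  rw [mgf_norm_sq_multivariateGaussian hC h3]
  refine ⟨Finset.prod_pos fun j _ => inv_pos.2 (Real.sqrt_pos.2 (by linarith [h3 j])), ?_⟩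
  calc ∏ j, (√(1 - 2 * (s * hC.1.eigenvalues j)))⁻¹
      ≤ ∏ j, Real.exp (s * hC.1.eigenvalues j + 4 * (s * hC.1.eigenvalues j) ^ 2) :=
        Finset.prod_le_prod (fun j _ => by positivity)
          fun j _ => inv_sqrt_one_sub_two_mul_le (h2 j)
    _ = Real.exp (s * C.trace + 4 * s ^ 2 * ∑ j, hC.1.eigenvalues j ^ 2) := by
        rw [← Real.exp_sum, Finset.sum_add_distrib, hC.1.trace_eq_sum_eigenvalues]
        simp only [Finset.mul_sum, mul_pow, mul_assoc]
        rfl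
    _ ≤ Real.exp (s * C.trace + 4 * s ^ 2 * (d * κ ^ 2)) := by
        gcongr
        calc ∑ j, hC.1.eigenvalues j ^ 2 ≤ ∑ _j : Fin d, κ ^ 2 :=
              Finset.sum_le_sum fun j _ => pow_le_pow_left₀ (h0 j) (h1 j) 2
          _ = d * κ ^ 2 := by simp

section Tail

variable {Ω : Type*} [MeasurableSpace Ω] {P : Measure Ω} {n : ℕ}
  {W : Fin n → Ω → EuclideanSpace ℝ (Fin d)}

theorem mgf_sum_norm_sq_bounds (hC : C.PosSemidef) {s κ : ℝ}
    (hκ : ∀ x : EuclideanSpace ℝ (Fin d), ⟪x, Matrix.toEuclideanCLM (𝕜 := ℝ) C x⟫ ≤ κ * ‖x‖ ^ 2)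
    (hs : |s| * κ ≤ 1 / 4) (hW : ∀ i, HasLaw (W i) (multivariateGaussian 0 C) P)
    (hind : iIndepFun W P) :
    0 < mgf (fun ω => ∑ i, ‖W i ω‖ ^ 2) P s ∧
      mgf (fun ω => ∑ i, ‖W i ω‖ ^ 2) P s ≤
        Real.exp (n * (s * C.trace + 4 * s ^ 2 * (d * κ ^ 2))) := by
  have h1 : (fun ω => ∑ i, ‖W i ω‖ ^ 2) = ∑ i, (fun ω => ‖W i ω‖ ^ 2) := by
    ext ω; simp
  have h2 : iIndepFun (fun i ω => ‖W i ω‖ ^ 2) P :=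
    hind.comp (fun _ x => ‖x‖ ^ 2) fun _ => by fun_prop
  have h3 : ∀ i, mgf (fun ω => ‖W i ω‖ ^ 2) P s =
      mgf (fun x => ‖x‖ ^ 2) (multivariateGaussian 0 C) s := by
    intro i
    rw [← (hW i).map_eq, mgf_map (hW i).aemeasurable
      (by apply Continuous.aestronglyMeasurable; fun_prop)]
    rfl
  obtain ⟨h4, h5⟩ := mgf_norm_sq_multivariateGaussian_bounds hC hκ hs
  rw [h1, h2.mgf_sum₀ (fun i => by have := (hW i).aemeasurable; fun_prop)]
  simp_rw [h3]
  rw [Finset.prod_const, Finset.card_univ, Fintype.card_fin]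
  refine ⟨pow_pos h4 n, ?_⟩
  rw [Real.exp_nat_mul]
  exact pow_le_pow_left₀ h4.le h5 n

/-- Bernstein-type bound for the sum of squared norms of i.i.d. centred Gaussian vectors. -/
theorem measureReal_sum_norm_sq_tail [IsProbabilityMeasure P] (hC : C.PosSemidef) {κ t : ℝ} (hκ0 : 0 < κ)
    (hκ : ∀ x : EuclideanSpace ℝ (Fin d), ⟪x, Matrix.toEuclideanCLM (𝕜 := ℝ) C x⟫ ≤ κ * ‖x‖ ^ 2)
    (ht0 : 0 ≤ t) (ht : t ≤ 2 * κ)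
    (hW : ∀ i, HasLaw (W i) (multivariateGaussian 0 C) P) (hind : iIndepFun W P) :
    P.real {ω | n * d * t ≤ |∑ i, ‖W i ω‖ ^ 2 - n * C.trace|} ≤
      2 * Real.exp (-(n * d * t ^ 2 / (16 * κ ^ 2))) := by
  set Z : Ω → ℝ := fun ω => ∑ i, ‖W i ω‖ ^ 2 with hZ
  -- The minimiser of `-s * t + 4 * s ^ 2 * κ ^ 2`, with value `-t ^ 2 / (16 * κ ^ 2)`. The
  -- condition `t ≤ 2 * κ` is exactly `s * κ ≤ 1 / 4`.
  set s : ℝ := t / (8 * κ ^ 2) with hs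
  have hs0 : 0 ≤ s := by positivity
  have hsκ : s * κ ≤ 1 / 4 := by
    rw [hs, div_mul_eq_mul_div, div_le_iff₀ (by positivity)]
    nlinarith
  have hup : P.real {ω | n * C.trace + n * d * t ≤ Z ω} ≤
      Real.exp (-(n * d * t ^ 2 / (16 * κ ^ 2))) := by
    obtain ⟨h1, h2⟩ := mgf_sum_norm_sq_bounds hC hκ (s := s)
      (by rwa [abs_of_nonneg hs0]) hW hind
    refine (measure_ge_le_exp_mul_mgf _ hs0 (mgf_pos_iff.1 h1)).trans ?_
    refine (mul_le_mul_of_nonneg_left h2 (Real.exp_pos _).le).trans ?_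
    rw [← Real.exp_add, Real.exp_le_exp, hs]
    apply le_of_eq
    field_simp
    ring
  have hlo : P.real {ω | Z ω ≤ n * C.trace - n * d * t} ≤
      Real.exp (-(n * d * t ^ 2 / (16 * κ ^ 2))) := by
    obtain ⟨h1, h2⟩ := mgf_sum_norm_sq_bounds hC hκ (s := -s)
      (by rwa [abs_neg, abs_of_nonneg hs0]) hW hind
    refine (measure_le_le_exp_mul_mgf _ (neg_nonpos.2 hs0) (mgf_pos_iff.1 h1)).trans ?_
    refine (mul_le_mul_of_nonneg_left h2 (Real.exp_pos _).le).trans ?_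
    rw [← Real.exp_add, Real.exp_le_exp, hs]
    apply le_of_eq
    field_simp
    ring
  have hsub : {ω | n * d * t ≤ |Z ω - n * C.trace|} ⊆
      {ω | n * C.trace + n * d * t ≤ Z ω} ∪ {ω | Z ω ≤ n * C.trace - n * d * t} := by
    intro ω hω
    rw [Set.mem_ofPred_eq] at hω
    rcases le_abs.1 hω with h | h
    · exact Or.inl (by rw [Set.mem_ofPred_eq]; linarith)
    · exact Or.inr (by rw [Set.mem_ofPred_eq]; linarith)
  calc P.real {ω | n * d * t ≤ |Z ω - n * C.trace|}
      ≤ _ := measureReal_mono hsub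
    _ ≤ _ := measureReal_union_le _ _
    _ ≤ _ := by linarith

end Tail

/-! ### Linear images of matrix normal samples and concentration of Gram matrices. -/

section Law

/-- Comparison of characteristic functions: moving `L` to its adjoint `L'` evaluates the original
one at `L' t`. -/
theorem map_multivariateGaussian_eq {ι κ : Type*} [Fintype ι] [DecidableEq ι] [Fintype κ]
    [DecidableEq κ] {K : Matrix ι ι ℝ} {K' : Matrix κ κ ℝ} (hK : K.PosSemidef)
    (hK' : K'.PosSemidef) (L : EuclideanSpace ℝ ι → EuclideanSpace ℝ κ) (hL : Continuous L)
    (L' : EuclideanSpace ℝ κ → EuclideanSpace ℝ ι) (hadj : ∀ x t, ⟪L x, t⟫ = ⟪x, L' t⟫)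
    (hquad : ∀ t, L' t ⬝ᵥ K *ᵥ L' t = t ⬝ᵥ K' *ᵥ t) :
    (multivariateGaussian 0 K).map L = multivariateGaussian 0 K' := by
  have : IsFiniteMeasure ((multivariateGaussian 0 K).map L) := Measure.isFiniteMeasure_map _ _
  apply Measure.ext_of_charFun
  ext t
  have h1 := charFun_multivariateGaussian (μ := 0) hK (L' t)
  rw [charFun_multivariateGaussian hK', ← hquad]
  rw [charFun_apply] at h1
  rw [charFun_apply, integral_map hL.aemeasurable
    (by apply Continuous.aestronglyMeasurable; fun_prop)]
  simp_rw [hadj]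
  rw [h1]
  simp

variable {Ω : Type*} [MeasurableSpace Ω] {P : Measure Ω} {p q n : ℕ}
  {S : Matrix (Fin p) (Fin p) ℝ} {T : Matrix (Fin q) (Fin q) ℝ}

theorem kronecker_vecMulVec_quadratic (t : Fin q → ℝ) (v : Fin p → ℝ) :
    (fun k : Fin q × Fin p => t k.1 * v k.2) ⬝ᵥ
      (T ⊗ₖ S) *ᵥ (fun k : Fin q × Fin p => t k.1 * v k.2) =
      (t ⬝ᵥ T *ᵥ t) * (v ⬝ᵥ S *ᵥ v) := by
  have h : (T ⊗ₖ S) *ᵥ (fun k : Fin q × Fin p => t k.1 * v k.2) =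
      fun k => (T *ᵥ t) k.1 * (S *ᵥ v) k.2 := by
    ext ⟨j, i⟩
    simp only [Matrix.mulVec, dotProduct, Fintype.sum_prod_type, Matrix.kroneckerMap_apply,
      Finset.sum_mul_sum]
    exact Finset.sum_congr rfl fun j' _ => Finset.sum_congr rfl fun i' _ => by ring
  rw [h]
  simp only [dotProduct, Fintype.sum_prod_type, Finset.sum_mul_sum]
  exact Finset.sum_congr rfl fun j' _ => Finset.sum_congr rfl fun i' _ => by ring

/-- The adjoint of `vec Y ↦ Yᵀ v` is `t ↦ t ⊗ v`, and the Kronecker form factors on such product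
vectors. -/
theorem hasLaw_transpose_mulVec {Y : Ω → Matrix (Fin p) (Fin q) ℝ} (hS : S.PosSemidef)
    (hT : T.PosSemidef) (hY : IsMatrixNormal P Y S T) (v : Fin p → ℝ) :
    HasLaw (fun ω => WithLp.toLp 2 ((Y ω)ᵀ *ᵥ v))
      (multivariateGaussian 0 ((v ⬝ᵥ S *ᵥ v) • T)) P := by
  have hv : 0 ≤ v ⬝ᵥ S *ᵥ v := by simpa using hS.dotProduct_mulVec_nonneg v
  let L : EuclideanSpace ℝ (Fin q × Fin p) → EuclideanSpace ℝ (Fin q) :=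
    fun x => WithLp.toLp 2 fun j => ∑ i, x (j, i) * v i
  have hL : Continuous L := by fun_prop
  have hLm := map_multivariateGaussian_eq (hT.kronecker hS) (hT.smul hv) L hL
    (fun t => WithLp.toLp 2 fun k => t k.1 * v k.2) (by
      intro x t
      simp only [L, PiLp.inner_apply, Fintype.sum_prod_type]
      refine Finset.sum_congr rfl fun j _ => ?_
      simp only [RCLike.inner_apply, conj_trivial, Finset.mul_sum]
      refine Finset.sum_congr rfl fun i _ => ?_
      ring) (by
      intro t
      have := kronecker_vecMulVec_quadratic (S := S) (T := T) t v
      simp only [Matrix.smul_mulVec, dotProduct_smul, smul_eq_mul]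
      rw [mul_comm]
      exact this)
  have h : HasLaw L (multivariateGaussian 0 ((v ⬝ᵥ S *ᵥ v) • T))
      (multivariateGaussian 0 (T ⊗ₖ S)) := ⟨hL.aemeasurable, hLm⟩
  exact h.fun_comp hY

theorem IsMatrixNormal.transpose {Y : Ω → Matrix (Fin p) (Fin q) ℝ} (hS : S.PosSemidef)
    (hT : T.PosSemidef) (hY : IsMatrixNormal P Y S T) :
    IsMatrixNormal P (fun ω => (Y ω)ᵀ) T S := by
  let L : EuclideanSpace ℝ (Fin q × Fin p) → EuclideanSpace ℝ (Fin p × Fin q) :=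
    fun x => WithLp.toLp 2 fun k => x k.swap
  have hL : Continuous L := by fun_prop
  have hLm := map_multivariateGaussian_eq (hT.kronecker hS) (hS.kronecker hT) L hL
    (fun t => WithLp.toLp 2 fun k => t k.swap) (by
      intro x t
      simp only [L, PiLp.inner_apply]
      exact Fintype.sum_equiv (Equiv.prodComm _ _) _ _ fun k => rfl) (by
      intro t
      simp only [dotProduct, Matrix.mulVec, Matrix.kroneckerMap_apply]
      refine Fintype.sum_equiv (Equiv.prodComm _ _) _ _ fun k => ?_
      refine congrArg₂ _ rfl (Fintype.sum_equiv (Equiv.prodComm _ _) _ _ fun l => ?_)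
      simp only [Equiv.prodComm_apply, Prod.fst_swap, Prod.snd_swap]
      ring)
  have h : HasLaw L (multivariateGaussian 0 (S ⊗ₖ T))
      (multivariateGaussian 0 (T ⊗ₖ S)) := ⟨hL.aemeasurable, hLm⟩
  exact h.fun_comp hY

theorem IsMatrixNormalSample.transpose {Y : Fin n → Ω → Matrix (Fin p) (Fin q) ℝ}
    (hS : S.PosSemidef) (hT : T.PosSemidef) (hY : IsMatrixNormalSample P Y S T) :
    IsMatrixNormalSample P (fun i ω => (Y i ω)ᵀ) T S := by
  refine ⟨fun i => (hY.1 i).transpose hS hT, ?_⟩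
  let L : EuclideanSpace ℝ (Fin q × Fin p) → EuclideanSpace ℝ (Fin p × Fin q) :=
    fun x => WithLp.toLp 2 fun k => x k.swap
  have hL : Measurable L := by fun_prop
  exact hY.2.comp (fun _ => L) fun _ => hL

theorem iIndepFun_transpose_mulVec {Y : Fin n → Ω → Matrix (Fin p) (Fin q) ℝ}
    (hY : IsMatrixNormalSample P Y S T) (v : Fin p → ℝ) :
    iIndepFun (fun i ω => WithLp.toLp 2 ((Y i ω)ᵀ *ᵥ v) : Fin n → Ω → EuclideanSpace ℝ (Fin q))
      P := by
  let L : EuclideanSpace ℝ (Fin q × Fin p) → EuclideanSpace ℝ (Fin q) :=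
    fun x => WithLp.toLp 2 fun j => ∑ i, x (j, i) * v i
  have hL : Measurable L := by fun_prop
  exact hY.2.comp (fun _ => L) fun _ => hL

/-- Concentration in spectral norm of the normalised row Gram matrix of a matrix normal sample. -/
theorem measureReal_norm_gram_sub_tail [IsProbabilityMeasure P]
    {Y : Fin n → Ω → Matrix (Fin p) (Fin q) ℝ} {τ t : ℝ} (hτ : 0 < τ) (hn : 1 ≤ n) (hq : 1 ≤ q)
    (hS : EigenvaluesIn S τ (1 / τ)) (hT : EigenvaluesIn T τ (1 / τ))
    (hY : IsMatrixNormalSample P Y S T) (ht0 : 0 ≤ t) (ht : t ≤ 32 / τ ^ 2) :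
    P.real {ω | t < ‖((n : ℝ) * q)⁻¹ • ∑ i, Y i ω * (Y i ω)ᵀ - (T.trace / q) • S‖} ≤
      4 * 25 ^ p * Real.exp (-(n * q * t ^ 2 / (16 * (16 / τ ^ 2) ^ 2))) := by
  obtain ⟨N, hcard, hN4, hN⟩ := exists_finset_norm_le_of_quadratic p
  have hSp := (hS.posDef hτ).posSemidef
  have hTp := (hT.posDef hτ).posSemidef
  have hn' : (0 : ℝ) < n := by exact_mod_cast hn
  have hq' : (0 : ℝ) < q := by exact_mod_cast hq
  -- Test vectors have norm at most 4, so `vᵀ S v ≤ 16 / τ`; the covariance `(vᵀ S v) T` is then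
  -- bounded by `16 / τ ^ 2`.
  set κ : ℝ := 16 / τ ^ 2 with hκ
  have hκ0 : 0 < κ := by positivity
  let D : Ω → Matrix (Fin p) (Fin p) ℝ := fun ω =>
    ((n : ℝ) * q)⁻¹ • ∑ i, Y i ω * (Y i ω)ᵀ - (T.trace / q) • S
  have hD : ∀ ω, (D ω).IsHermitian := by
    intro ω
    have h1 : ∀ i, (Y i ω * (Y i ω)ᵀ)ᵀ = Y i ω * (Y i ω)ᵀ := fun i => by simp
    have h2 : Sᵀ = S := by simpa using hS.isHermitian.eq
    rw [Matrix.IsHermitian, Matrix.conjTranspose_eq_transpose_of_trivial]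
    simp [D, Matrix.transpose_sum, h2]
  let W : (Fin p → ℝ) → Fin n → Ω → EuclideanSpace ℝ (Fin q) :=
    fun v i ω => WithLp.toLp 2 ((Y i ω)ᵀ *ᵥ v)
  have hquad : ∀ (v : EuclideanSpace ℝ (Fin p)) ω,
      n * q * ⟪v, Matrix.toEuclideanCLM (𝕜 := ℝ) (D ω) v⟫ =
        ∑ i, ‖W v i ω‖ ^ 2 - n * (((v : Fin p → ℝ) ⬝ᵥ S *ᵥ v) • T).trace := by
    intro v ω
    have h1 : ∀ i, (v : Fin p → ℝ) ⬝ᵥ (Y i ω * (Y i ω)ᵀ) *ᵥ v = ‖W v i ω‖ ^ 2 := by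
      intro i
      rw [EuclideanSpace.real_norm_sq_eq, ← Matrix.mulVec_mulVec, Matrix.dotProduct_mulVec,
        ← Matrix.mulVec_transpose]
      simp [W, dotProduct, sq]
    rw [Matrix.inner_toEuclideanCLM]
    simp only [D, Matrix.sub_mulVec, Matrix.smul_mulVec, dotProduct_sub, dotProduct_smul,
      Matrix.sum_mulVec, dotProduct_sum, h1, Matrix.trace_smul, smul_eq_mul]
    field_simp
  have hpt : ∀ v ∈ N, P.real {ω | t ≤ |⟪v, Matrix.toEuclideanCLM (𝕜 := ℝ) (D ω) v⟫|} ≤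
      2 * Real.exp (-(n * q * t ^ 2 / (16 * κ ^ 2))) := by
    intro v hv
    have hv0 : 0 ≤ (v : Fin p → ℝ) ⬝ᵥ S *ᵥ v := by simpa using hSp.dotProduct_mulVec_nonneg v
    have hv1 : (v : Fin p → ℝ) ⬝ᵥ S *ᵥ v ≤ 16 / τ := by
      have h := hS.inner_le v
      rw [Matrix.inner_toEuclideanCLM] at h
      have h4 : ‖v‖ ^ 2 ≤ 16 := by
        have := pow_le_pow_left₀ (norm_nonneg v) (hN4 v hv) 2
        norm_num at this; exact this
      calc _ ≤ 1 / τ * ‖v‖ ^ 2 := h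
        _ ≤ 1 / τ * 16 := by gcongr
        _ = 16 / τ := by ring
    have hb : ∀ x : EuclideanSpace ℝ (Fin q),
        ⟪x, Matrix.toEuclideanCLM (𝕜 := ℝ) (((v : Fin p → ℝ) ⬝ᵥ S *ᵥ v) • T) x⟫ ≤
          κ * ‖x‖ ^ 2 := by
      intro x
      rw [map_smul, smul_apply, real_inner_smul_right]
      calc _ ≤ ((v : Fin p → ℝ) ⬝ᵥ S *ᵥ v) * (1 / τ * ‖x‖ ^ 2) := by
            gcongr; exact hT.inner_le x
        _ ≤ 16 / τ * (1 / τ * ‖x‖ ^ 2) := by gcongr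
        _ = κ * ‖x‖ ^ 2 := by rw [hκ]; field_simp
    have key := measureReal_sum_norm_sq_tail (P := P) (W := W v) (hTp.smul hv0) hκ0 hb ht0
      (by rw [hκ]; convert ht using 1; ring)
      (fun i => hasLaw_transpose_mulVec hSp hTp (hY.1 i) v) (iIndepFun_transpose_mulVec hY v)
    convert key using 3
    ext ω
    rw [← hquad, abs_mul,
      abs_of_pos (mul_pos hn' hq'), mul_le_mul_iff_right₀ (mul_pos hn' hq')]
  have hsub : {ω | t < ‖D ω‖} ⊆
      ⋃ v ∈ N, {ω | t ≤ |⟪v, Matrix.toEuclideanCLM (𝕜 := ℝ) (D ω) v⟫|} := by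
    intro ω hω
    by_contra hcon
    simp only [Set.mem_iUnion, Set.mem_ofPred_eq, not_exists, not_le] at hcon
    exact absurd (hN (D ω) t (hD ω) fun v hv => (hcon v hv).le) (not_le.2 hω)
  calc P.real {ω | t < ‖D ω‖} ≤ _ := measureReal_mono hsub (measure_ne_top _ _)
    _ ≤ ∑ v ∈ N, P.real {ω | t ≤ |⟪v, Matrix.toEuclideanCLM (𝕜 := ℝ) (D ω) v⟫|} :=
      measureReal_biUnion_finset_le _ _
    _ ≤ ∑ _v ∈ N, 2 * Real.exp (-(n * q * t ^ 2 / (16 * κ ^ 2))) := Finset.sum_le_sum hpt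
    _ = N.card * (2 * Real.exp (-(n * q * t ^ 2 / (16 * κ ^ 2)))) := by simp
    _ ≤ (2 * 25 ^ p) * (2 * Real.exp (-(n * q * t ^ 2 / (16 * κ ^ 2)))) := by gcongr
    _ = _ := by ring

end Law

/-! ### Deterministic error bound for the column estimator. -/

theorem norm_psiHat_sub_le {n p q : ℕ} {Y : Fin n → Matrix (Fin p) (Fin q) ℝ}
    {S : Matrix (Fin p) (Fin p) ℝ} {T : Matrix (Fin q) (Fin q) ℝ} {τ a b : ℝ} (hτ : 0 < τ)
    (hp : 1 ≤ p) (hS : EigenvaluesIn S τ (1 / τ)) (hT : EigenvaluesIn T τ (1 / τ))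
    (ha : ‖sigmaHat Y - S‖ ≤ a) (haτ : a ≤ τ / 2)
    (hb : ‖((n : ℝ) * p)⁻¹ • ∑ i, (Y i)ᵀ * Y i - (S.trace / p) • T‖ ≤ b) :
    ‖psiHat Y - T‖ ≤ 2 / τ * (b + a / τ) := by
  have hp' : (0 : ℝ) < p := by exact_mod_cast hp
  have ha0 : 0 ≤ a := (norm_nonneg _).trans ha
  have hb0 : 0 ≤ b := (norm_nonneg _).trans hb
  set G := ((n : ℝ) * p)⁻¹ • ∑ i, (Y i)ᵀ * Y i with hG
  set c : ℝ := (sigmaHat Y).trace / p with hc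
  have h1 : |c - S.trace / p| ≤ a := by
    rw [hc, ← sub_div, ← Matrix.trace_sub, abs_div, abs_of_pos hp', div_le_iff₀ hp']
    calc _ ≤ p * ‖sigmaHat Y - S‖ := abs_trace_le _
      _ ≤ a * p := by rw [mul_comm]; gcongr
  have h2 : τ ≤ S.trace / p := by
    rw [le_div_iff₀ hp', mul_comm]; exact hS.le_trace
  -- The normalised trace `c` is within `a ≤ τ / 2` of a number that is at least `τ`, so dividing by
  -- it is harmless.
  have h3 : τ / 2 ≤ c := by linarith [(abs_le.1 h1).1]
  have hc0 : 0 < c := by linarith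
  have hcinv : c⁻¹ ≤ 2 / τ := by
    rw [inv_le_comm₀ hc0 (by positivity), inv_div]; exact h3
  have hpsi : psiHat Y = c⁻¹ • G := by
    rw [psiHat, hG, smul_smul, hc, inv_div, mul_inv, mul_inv]
    congr 1
    field_simp
  -- Separates the fluctuation of the Gram matrix from the error in the estimated scale.
  have hdec : psiHat Y - T =
      c⁻¹ • (G - (S.trace / p) • T) + (c⁻¹ * (S.trace / p - c)) • T := by
    have h4 : c⁻¹ * (S.trace / p - c) = c⁻¹ * (S.trace / p) - 1 := by
      rw [mul_sub, inv_mul_cancel₀ hc0.ne']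
    rw [hpsi, h4]
    module
  have hTn : ‖T‖ ≤ 1 / τ := hT.norm_le hτ (by positivity)
  calc ‖psiHat Y - T‖ ≤ ‖c⁻¹ • (G - (S.trace / p) • T)‖ + ‖(c⁻¹ * (S.trace / p - c)) • T‖ := by
        rw [hdec]; exact norm_add_le _ _
    _ = c⁻¹ * ‖G - (S.trace / p) • T‖ + c⁻¹ * |c - S.trace / p| * ‖T‖ := by
        rw [norm_smul, norm_smul, norm_mul, Real.norm_of_nonneg (inv_pos.2 hc0).le,
          Real.norm_eq_abs, abs_sub_comm]
    _ ≤ 2 / τ * b + 2 / τ * a * (1 / τ) := by gcongr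
    _ = 2 / τ * (b + a / τ) := by ring

/-! ### Passage to limits in probability. -/

section Prob

variable {Ω : ℕ → Type*} [∀ n, MeasurableSpace (Ω n)] {P : ∀ n, Measure (Ω n)}
  {B : ∀ n, Set (Ω n)}

/-- Since the exceptional events have vanishing probability, one constant `M` serves every `ε`. -/
theorem IsBigOInProb.of_eventually_le (hB : Tendsto (fun n => P n (B n)) atTop (𝓝 0))
    {X : ∀ n, Ω n → ℝ} {r : ℕ → ℝ} {M : ℝ} (hM : 0 < M)
    (h : ∀ᶠ n in atTop, ∀ ω ∉ B n, |X n ω| ≤ M * r n) : IsBigOInProb P X r := by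
  intro ε hε
  refine ⟨M, hM, ?_⟩
  have h0 : (0 : ENNReal) < ENNReal.ofReal ε := ENNReal.ofReal_pos.2 hε
  filter_upwards [h, hB.eventually_le_const h0] with n hn hle
  refine (measure_mono fun ω hω => ?_).trans hle
  by_contra hcon
  exact absurd (hn ω hcon) (not_le.2 hω)

theorem TendstoZeroInProb.of_eventually_le (hB : Tendsto (fun n => P n (B n)) atTop (𝓝 0))
    {X : ∀ n, Ω n → ℝ} {r : ℕ → ℝ} (hr : Tendsto r atTop (𝓝 0))
    (h : ∀ᶠ n in atTop, ∀ ω ∉ B n, |X n ω| ≤ r n) : TendstoZeroInProb P X := by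
  intro ε hε
  refine tendsto_of_tendsto_of_tendsto_of_le_of_le' tendsto_const_nhds hB
    (Eventually.of_forall fun _ => zero_le) ?_
  filter_upwards [h, hr.eventually_le_const hε] with n hn hle
  refine measure_mono fun ω hω => ?_
  by_contra hcon
  exact absurd ((hn ω hcon).trans hle) (not_le.2 hω)

/-- Subadditivity gives `1 ≤ P (A n) + P (B n)` with no measurability of either set. -/
theorem tendsto_measure_one_of_eventually [∀ n, IsProbabilityMeasure (P n)]
    (hB : Tendsto (fun n => P n (B n)) atTop (𝓝 0)) {A : ∀ n, Set (Ω n)}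
    (h : ∀ᶠ n in atTop, ∀ ω ∉ B n, ω ∈ A n) : Tendsto (fun n => P n (A n)) atTop (𝓝 1) := by
  have h1 : Tendsto (fun n => 1 - P n (B n)) atTop (𝓝 1) := by
    simpa using ENNReal.Tendsto.sub tendsto_const_nhds hB (Or.inl ENNReal.one_ne_top)
  refine tendsto_of_tendsto_of_tendsto_of_le_of_le' h1 tendsto_const_nhds ?_
    (Eventually.of_forall fun _ => prob_le_one)
  filter_upwards [h] with n hn
  rw [tsub_le_iff_right, ← measure_univ (μ := P n)]
  refine (measure_mono fun ω _ => ?_).trans (measure_union_le _ _)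
  by_cases hω : ω ∈ B n
  exacts [Or.inr hω, Or.inl (hn ω hω)]

theorem tendsto_max_log_div {p q : ℕ → ℕ}
    (h : (fun n => max (p n : ℝ) (Real.log n) / q n) =o[atTop] (fun n => (n : ℝ))) :
    Tendsto (fun n => max (p n : ℝ) (Real.log n) / ((n : ℝ) * q n)) atTop (𝓝 0) := by
  refine h.tendsto_div_nhds_zero.congr fun n => ?_
  rw [div_div, mul_comm]

theorem tendsto_sigmaRate {p q : ℕ → ℕ}
    (h : (fun n => max (p n : ℝ) (Real.log n) / q n) =o[atTop] (fun n => (n : ℝ))) :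
    Tendsto (sigmaRate p q) atTop (𝓝 0) := by
  have := (tendsto_max_log_div h).sqrt
  rwa [Real.sqrt_zero] at this

theorem tendsto_psiRate {p q : ℕ → ℕ}
    (hpq : (fun n => max (p n : ℝ) (Real.log n) / q n) =o[atTop] (fun n => (n : ℝ)))
    (hqp : (fun n => max (q n : ℝ) (Real.log n) / p n) =o[atTop] (fun n => (n : ℝ))) :
    Tendsto (psiRate p q) atTop (𝓝 0) := by
  have := ((tendsto_max_log_div hpq).max (tendsto_max_log_div hqp)).sqrt
  rwa [max_self, Real.sqrt_zero] at this

/-- As `25 ≤ e⁴`, the cardinality factor uses up at most 4 of the 9 units of the exponent; the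
remaining ones exceed `log n`. -/
theorem card_mul_exp_neg_le {p n : ℕ} (hn : 1 ≤ n) :
    4 * 25 ^ p * Real.exp (-(9 * max (p : ℝ) (Real.log n))) ≤ 4 / n := by
  have hn' : (0 : ℝ) < n := by exact_mod_cast hn
  have h25 : (25 : ℝ) ≤ Real.exp 4 := by
    have h1 : (2.7 : ℝ) ≤ Real.exp 1 := by linarith [Real.exp_one_gt_d9]
    calc (25 : ℝ) ≤ 2.7 ^ 4 := by norm_num
      _ ≤ Real.exp 1 ^ 4 := by gcongr
      _ = Real.exp 4 := by rw [← Real.exp_nat_mul]; norm_num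
  have hpow : (25 : ℝ) ^ p ≤ Real.exp (4 * p) := by
    rw [mul_comm, Real.exp_nat_mul]; gcongr
  have hp := le_max_left (p : ℝ) (Real.log n)
  have hl := le_max_right (p : ℝ) (Real.log n)
  have hp0 : (0 : ℝ) ≤ p := p.cast_nonneg
  calc 4 * 25 ^ p * Real.exp (-(9 * max (p : ℝ) (Real.log n)))
      ≤ 4 * Real.exp (4 * p) * Real.exp (-(9 * max (p : ℝ) (Real.log n))) := by gcongr
    _ = 4 * Real.exp (4 * p + -(9 * max (p : ℝ) (Real.log n))) := by rw [mul_assoc, Real.exp_add]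
    _ ≤ 4 * Real.exp (-Real.log n) := by gcongr; linarith
    _ = 4 / n := by rw [Real.exp_neg, Real.exp_log hn', div_eq_mul_inv]

theorem tendsto_measure_norm_gram_sub [∀ n, IsProbabilityMeasure (P n)] {p q : ℕ → ℕ}
    (hq : ∀ n, 1 ≤ n → 1 ≤ q n)
    {S : ∀ n, Matrix (Fin (p n)) (Fin (p n)) ℝ} {T : ∀ n, Matrix (Fin (q n)) (Fin (q n)) ℝ}
    {Y : ∀ n, Fin n → Ω n → Matrix (Fin (p n)) (Fin (q n)) ℝ}
    (hY : ∀ n, 1 ≤ n → IsMatrixNormalSample (P n) (Y n) (S n) (T n)) {τ : ℝ} (hτ : 0 < τ)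
    (hS : ∀ n, 1 ≤ n → EigenvaluesIn (S n) τ (1 / τ))
    (hT : ∀ n, 1 ≤ n → EigenvaluesIn (T n) τ (1 / τ))
    (hpq : (fun n => max (p n : ℝ) (Real.log n) / q n) =o[atTop] (fun n => (n : ℝ))) :
    Tendsto (fun n => P n {ω | 192 / τ ^ 2 * sigmaRate p q n <
      ‖((n : ℝ) * q n)⁻¹ • ∑ i, Y n i ω * (Y n i ω)ᵀ - ((T n).trace / q n) • S n‖})
      atTop (𝓝 0) := by
  have hlim : Tendsto (fun n : ℕ => ENNReal.ofReal (4 / n)) atTop (𝓝 0) := by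
    simpa using ENNReal.tendsto_ofReal (tendsto_const_div_atTop_nhds_zero_nat 4)
  have hsmall : ∀ᶠ n in atTop, 192 / τ ^ 2 * sigmaRate p q n ≤ 32 / τ ^ 2 := by
    have := (tendsto_sigmaRate hpq).const_mul (192 / τ ^ 2)
    rw [mul_zero] at this
    exact this.eventually_le_const (by positivity)
  refine tendsto_of_tendsto_of_tendsto_of_le_of_le' tendsto_const_nhds hlim
    (Eventually.of_forall fun _ => zero_le) ?_
  filter_upwards [hsmall, eventually_ge_atTop 1] with n hn hn1
  have hn' : (0 : ℝ) < n := by exact_mod_cast hn1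
  have hq' : (0 : ℝ) < q n := by exact_mod_cast hq n hn1
  have hr0 : 0 ≤ sigmaRate p q n := Real.sqrt_nonneg _
  have key := measureReal_norm_gram_sub_tail hτ hn1 (hq n hn1) (hS n hn1) (hT n hn1) (hY n hn1)
    (by positivity) hn
  rw [← ofReal_measureReal]
  refine ENNReal.ofReal_le_ofReal (key.trans (le_trans (le_of_eq ?_) (card_mul_exp_neg_le (p := p n) hn1)))
  have hmax : 0 ≤ max (p n : ℝ) (Real.log n) := le_max_of_le_left (Nat.cast_nonneg _)
  -- The constant 192 is chosen so that `192 ^ 2 / (16 * 16 ^ 2) = 9`.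
  rw [mul_pow, sigmaRate, Real.sq_sqrt (by positivity)]
  congr 3
  field_simp
  ring

end Prob

end MatrixVariate

/-! ### Assembly on a single sequence of exceptional events. -/

theorem theorem4p1
    (p q : ℕ → ℕ) (hp : ∀ n, 1 ≤ n → 1 ≤ p n) (hq : ∀ n, 1 ≤ n → 1 ≤ q n)
    (Sigma₀ : ∀ n, Matrix (Fin (p n)) (Fin (p n)) ℝ)
    (Psi₀ : ∀ n, Matrix (Fin (q n)) (Fin (q n)) ℝ)
    {Ω : ℕ → Type*} [∀ n, MeasurableSpace (Ω n)]
    (P : ∀ n, Measure (Ω n)) [∀ n, IsProbabilityMeasure (P n)]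
    (Y : ∀ n, Fin n → Ω n → Matrix (Fin (p n)) (Fin (q n)) ℝ)
    (hY : ∀ n, 1 ≤ n → MatrixVariate.IsMatrixNormalSample (P n) (Y n) (Sigma₀ n) (Psi₀ n))
    (htr : ∀ n, 1 ≤ n → (Psi₀ n).trace = q n)
    (τ : ℝ) (hτ : 0 < τ)
    (hSigma : ∀ n, 1 ≤ n → MatrixVariate.EigenvaluesIn (Sigma₀ n) τ (1 / τ))
    (hPsi : ∀ n, 1 ≤ n → MatrixVariate.EigenvaluesIn (Psi₀ n) τ (1 / τ))
    (hpq : (fun n => max (p n : ℝ) (Real.log n) / q n) =o[atTop] (fun n => (n : ℝ)))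
    (hqp : (fun n => max (q n : ℝ) (Real.log n) / p n) =o[atTop] (fun n => (n : ℝ))) :
    -- convergence rates of the covariance estimators
    MatrixVariate.IsBigOInProb P
        (fun n ω => ‖MatrixVariate.sigmaHat (fun i => Y n i ω) - Sigma₀ n‖)
        (MatrixVariate.sigmaRate p q) ∧
      MatrixVariate.IsBigOInProb P
        (fun n ω => ‖MatrixVariate.psiHat (fun i => Y n i ω) - Psi₀ n‖)
        (MatrixVariate.psiRate p q) ∧
      -- consistency of the covariance estimators
      MatrixVariate.TendstoZeroInProb P
        (fun n ω => ‖MatrixVariate.sigmaHat (fun i => Y n i ω) - Sigma₀ n‖) ∧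
      MatrixVariate.TendstoZeroInProb P
        (fun n ω => ‖MatrixVariate.psiHat (fun i => Y n i ω) - Psi₀ n‖) ∧
      -- the covariance estimators are invertible with probability tending to one
      Tendsto (fun n => P n {ω | IsUnit (MatrixVariate.sigmaHat (fun i => Y n i ω))})
        atTop (𝓝 1) ∧
      Tendsto (fun n => P n {ω | IsUnit (MatrixVariate.psiHat (fun i => Y n i ω))})
        atTop (𝓝 1) ∧
      -- convergence rates of the precision matrix estimators
      MatrixVariate.IsBigOInProb P
        (fun n ω => ‖(MatrixVariate.sigmaHat (fun i => Y n i ω))⁻¹ - (Sigma₀ n)⁻¹‖)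
        (MatrixVariate.sigmaRate p q) ∧
      MatrixVariate.IsBigOInProb P
        (fun n ω => ‖(MatrixVariate.psiHat (fun i => Y n i ω))⁻¹ - (Psi₀ n)⁻¹‖)
        (MatrixVariate.psiRate p q) := by
  have hYt : ∀ n, 1 ≤ n →
      MatrixVariate.IsMatrixNormalSample (P n) (fun i ω => (Y n i ω)ᵀ) (Psi₀ n) (Sigma₀ n) := fun n hn =>
    (hY n hn).transpose ((hSigma n hn).posDef hτ).posSemidef ((hPsi n hn).posDef hτ).posSemidef
  set M : ℝ := 192 / τ ^ 2 with hM
  have hM0 : 0 < M := by positivity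
  set M' : ℝ := 2 / τ * (M + M / τ) with hM'
  have hM'0 : 0 < M' := by positivity
  -- Off `B n` both Gram matrices, of the sample and of its transpose, are close to their means;
  -- everything after this is deterministic.
  let B : ∀ n, Set (Ω n) := fun n =>
    {ω | M * MatrixVariate.sigmaRate p q n < ‖((n : ℝ) * q n)⁻¹ • ∑ i, Y n i ω * (Y n i ω)ᵀ -
      ((Psi₀ n).trace / q n) • Sigma₀ n‖} ∪
    {ω | M * MatrixVariate.sigmaRate q p n <
      ‖((n : ℝ) * p n)⁻¹ • ∑ i, (Y n i ω)ᵀ * ((Y n i ω)ᵀ)ᵀ -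
      ((Sigma₀ n).trace / p n) • Psi₀ n‖}
  have hB : Tendsto (fun n => P n (B n)) atTop (𝓝 0) := by
    have h1 := MatrixVariate.tendsto_measure_norm_gram_sub hq hY hτ hSigma hPsi hpq
    have h2 := MatrixVariate.tendsto_measure_norm_gram_sub hp hYt hτ hPsi hSigma hqp
    have h3 := h1.add h2
    rw [add_zero] at h3
    exact tendsto_of_tendsto_of_tendsto_of_le_of_le tendsto_const_nhds h3
      (fun _ => zero_le) fun n => measure_union_le _ _
  have hr := (MatrixVariate.tendsto_sigmaRate hpq).const_mul M
  have hs := (MatrixVariate.tendsto_psiRate hpq hqp).const_mul M'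
  rw [mul_zero] at hr hs
  have hrs : ∀ n, MatrixVariate.sigmaRate p q n ≤ MatrixVariate.psiRate p q n := fun n =>
    Real.sqrt_le_sqrt (le_max_left _ _)
  have hrs' : ∀ n, MatrixVariate.sigmaRate q p n ≤ MatrixVariate.psiRate p q n := fun n =>
    Real.sqrt_le_sqrt (le_max_right _ _)
  have hdevS : ∀ᶠ n in atTop, ∀ ω ∉ B n,
      ‖MatrixVariate.sigmaHat (fun i => Y n i ω) - Sigma₀ n‖ ≤
        M * MatrixVariate.sigmaRate p q n := by
    filter_upwards [eventually_ge_atTop 1] with n hn ω hω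
    have hq' : (0 : ℝ) < q n := by exact_mod_cast hq n hn
    simp only [B, Set.mem_union, Set.mem_ofPred_eq, not_or, not_lt] at hω
    have h := hω.1
    -- The normalisation `tr Ψ₀ = q` removes the scale factor in front of `Sigma₀ n`.
    rwa [htr n hn, div_self hq'.ne', one_smul] at h
  have hdevP : ∀ᶠ n in atTop, ∀ ω ∉ B n,
      ‖MatrixVariate.psiHat (fun i => Y n i ω) - Psi₀ n‖ ≤
        M' * MatrixVariate.psiRate p q n := by
    filter_upwards [eventually_ge_atTop 1, hdevS, hr.eventually_le_const (half_pos hτ)]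
      with n hn hdev hsmall ω hω
    have h := hω
    simp only [B, Set.mem_union, Set.mem_ofPred_eq, not_or, not_lt,
      Matrix.transpose_transpose] at h
    refine (MatrixVariate.norm_psiHat_sub_le hτ (hp n hn) (hSigma n hn) (hPsi n hn)
      (hdev ω hω) hsmall h.2).trans ?_
    calc 2 / τ * (M * MatrixVariate.sigmaRate q p n + M * MatrixVariate.sigmaRate p q n / τ)
        ≤ 2 / τ * (M * MatrixVariate.psiRate p q n + M * MatrixVariate.psiRate p q n / τ) := by
          gcongr
          exacts [hrs' n, hrs n]
      _ = M' * MatrixVariate.psiRate p q n := by rw [hM']; ring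
  have hinvS : ∀ᶠ n in atTop, ∀ ω ∉ B n,
      IsUnit (MatrixVariate.sigmaHat (fun i => Y n i ω)) ∧
      ‖(MatrixVariate.sigmaHat (fun i => Y n i ω))⁻¹ - (Sigma₀ n)⁻¹‖ ≤
        2 / τ ^ 2 * M * MatrixVariate.sigmaRate p q n := by
    filter_upwards [eventually_ge_atTop 1, hdevS, hr.eventually_le_const (half_pos hτ)]
      with n hn hdev hsmall ω hω
    obtain ⟨h1, h2⟩ := MatrixVariate.isUnit_and_norm_inv_sub_inv_le hτ ((hSigma n hn).isUnit hτ)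
      ((hSigma n hn).norm_inv_le hτ) ((hdev ω hω).trans hsmall)
    refine ⟨h1, h2.trans ?_⟩
    rw [mul_assoc]
    gcongr
    exact hdev ω hω
  have hinvP : ∀ᶠ n in atTop, ∀ ω ∉ B n,
      IsUnit (MatrixVariate.psiHat (fun i => Y n i ω)) ∧
      ‖(MatrixVariate.psiHat (fun i => Y n i ω))⁻¹ - (Psi₀ n)⁻¹‖ ≤
        2 / τ ^ 2 * M' * MatrixVariate.psiRate p q n := by
    filter_upwards [eventually_ge_atTop 1, hdevP, hs.eventually_le_const (half_pos hτ)]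
      with n hn hdev hsmall ω hω
    obtain ⟨h1, h2⟩ := MatrixVariate.isUnit_and_norm_inv_sub_inv_le hτ ((hPsi n hn).isUnit hτ)
      ((hPsi n hn).norm_inv_le hτ) ((hdev ω hω).trans hsmall)
    refine ⟨h1, h2.trans ?_⟩
    rw [mul_assoc]
    gcongr
    exact hdev ω hω
  refine ⟨.of_eventually_le hB hM0 ?_, .of_eventually_le hB hM'0 ?_,
    .of_eventually_le hB hr ?_, .of_eventually_le hB hs ?_,
    MatrixVariate.tendsto_measure_one_of_eventually hB
      (hinvS.mono fun n h ω hω => (h ω hω).1),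
    MatrixVariate.tendsto_measure_one_of_eventually hB
      (hinvP.mono fun n h ω hω => (h ω hω).1),
    .of_eventually_le hB (M := 2 / τ ^ 2 * M) (by positivity) ?_,
    .of_eventually_le hB (M := 2 / τ ^ 2 * M') (by positivity) ?_⟩
  all_goals simp only [abs_norm]
  exacts [hdevS, hdevP, hdevS, hdevP, hinvS.mono fun n h ω hω => (h ω hω).2,
    hinvP.mono fun n h ω hω => (h ω hω).2]
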